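/- Let $n\ge 1$, let $a_1,\dots,a_n>0$, and let $\mathcal E=\{x\in\mathbb R^n:\sum_{i=1}^n (x^i)^2/a_i=1\}$. Then the restriction to $\mathcal E$ of the Euclidean metric $\sum_{i=1}^n (dx^i)^2$ and the restriction to $\mathcal E$ of the metric $$\frac{1}{\sum_{i=1}^n\left(\frac{x^i}{a_i}\right)^2}\left(\sum_{i=1}^n\frac{(dx^i)^2}{a_i}\right)$$ are geodesically equivalent; that is, they have the same geodesics, considered as unparametrized curves on $\mathcal E$. -/

import Mathlib

open scoped ContDiff

noncomputable section

/-- A smooth Riemannian metric given near the subset `M` of `ℝⁿ`: a field of bilinear forms which is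
smooth at the points of `M`, and symmetric and positive definite there. If `M` is an embedded
submanifold, its restriction to the tangent spaces of `M` is a Riemannian metric on `M`. -/
structure MetricNear {n : ℕ} (M : Set (EuclideanSpace ℝ (Fin n))) where
  form : EuclideanSpace ℝ (Fin n) →
    EuclideanSpace ℝ (Fin n) →L[ℝ] EuclideanSpace ℝ (Fin n) →L[ℝ] ℝ
  smooth : ∀ x ∈ M, ContDiffAt ℝ ∞ form x
  symm : ∀ x ∈ M, ∀ v w, form x v w = form x w v
  pos : ∀ x ∈ M, ∀ v, v ≠ 0 → 0 < form x v v

/-- A local parametrization (inverse of a chart) of the `m`-dimensional embedded submanifold `M` of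
`ℝⁿ`: a smooth injective immersion of an open subset of `ℝᵐ` which is a homeomorphism onto a
relatively open subset of `M`. -/
structure LocalParametrization {n : ℕ} (M : Set (EuclideanSpace ℝ (Fin n))) (m : ℕ) where
  toFun : EuclideanSpace ℝ (Fin m) → EuclideanSpace ℝ (Fin n)
  source : Set (EuclideanSpace ℝ (Fin m))
  open_source : IsOpen source
  smooth : ContDiffOn ℝ ∞ toFun source
  injOn : Set.InjOn toFun source
  immersion : ∀ u ∈ source, Function.Injective (fderiv ℝ toFun u)
  open_image : ∀ V ⊆ source, IsOpen V → ∃ W, IsOpen W ∧ toFun '' V = W ∩ M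

namespace LocalParametrization

variable {n m : ℕ} {M : Set (EuclideanSpace ℝ (Fin n))}

/-- The coordinate tangent vector `∂φ/∂uⁱ` of the parametrization `φ`. -/
def tangentVec (P : LocalParametrization M m) (u : EuclideanSpace ℝ (Fin m)) (i : Fin m) :
    EuclideanSpace ℝ (Fin n) :=
  fderiv ℝ P.toFun u (EuclideanSpace.single i 1)

/-- The coefficients `h_{ij} = g(∂φ/∂uⁱ, ∂φ/∂uʲ)` of the metric on `M` obtained by restricting `g`,
in the coordinates `u`. -/
def coeff (P : LocalParametrization M m) (g : MetricNear M) (u : EuclideanSpace ℝ (Fin m)) :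
    Matrix (Fin m) (Fin m) ℝ :=
  Matrix.of fun i j => g.form (P.toFun u) (P.tangentVec u i) (P.tangentVec u j)

/-- The partial derivative `∂h_{ij}/∂uᵏ`. -/
def coeffDeriv (P : LocalParametrization M m) (g : MetricNear M) (u : EuclideanSpace ℝ (Fin m))
    (k i j : Fin m) : ℝ :=
  fderiv ℝ (fun v => P.coeff g v i j) u (EuclideanSpace.single k 1)

/-- The Christoffel symbols
`Γᵏ_{ij} = ½ ∑ₗ hᵏˡ (∂ᵢ h_{jl} + ∂ⱼ h_{il} - ∂ₗ h_{ij})` of the restricted metric. -/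
def christoffel (P : LocalParametrization M m) (g : MetricNear M) (u : EuclideanSpace ℝ (Fin m))
    (k i j : Fin m) : ℝ :=
  (1 / 2) * ∑ l, (P.coeff g u)⁻¹ k l *
    (P.coeffDeriv g u i j l + P.coeffDeriv g u j i l - P.coeffDeriv g u l i j)

end LocalParametrization

/-- `γ` is, on the open set `I` of parameters, a (smooth, affinely parametrized) geodesic of the
metric on the `m`-dimensional submanifold `M` obtained by restricting `g`: around each parameter
`t ∈ I`, the curve runs in the image of a local parametrization of `M`, its coordinate
expression `u` is smooth there, and the geodesic equation `üᵏ + ∑ᵢⱼ Γᵏ_{ij} u̇ⁱ u̇ʲ = 0` holds at `t`.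
(This equation does not depend on the choice of the coordinates.) -/
def IsGeodesicOn {n : ℕ} {M : Set (EuclideanSpace ℝ (Fin n))} (m : ℕ) (g : MetricNear M)
    (γ : ℝ → EuclideanSpace ℝ (Fin n)) (I : Set ℝ) : Prop :=
  ∀ t ∈ I, ∃ (P : LocalParametrization M m) (u : ℝ → EuclideanSpace ℝ (Fin m)),
    u t ∈ P.source ∧ ContDiffAt ℝ ∞ u t ∧ (∀ᶠ s in nhds t, γ s = P.toFun (u s)) ∧
    ∀ k, deriv (deriv u) t k +
      ∑ i, ∑ j, P.christoffel g (u t) k i j * deriv u t i * deriv u t j = 0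

/-- `γ`, on the open interval `I`, is an unparametrized geodesic: after a smooth change of
parameter `τ : J → I` with positive derivative, `J` an open interval, it is a geodesic. -/
def IsUnparametrizedGeodesicOn {n : ℕ} {M : Set (EuclideanSpace ℝ (Fin n))} (m : ℕ)
    (g : MetricNear M) (γ : ℝ → EuclideanSpace ℝ (Fin n)) (I : Set ℝ) : Prop :=
  ∃ (J : Set ℝ) (τ : ℝ → ℝ), IsOpen J ∧ J.OrdConnected ∧ ContDiffOn ℝ ∞ τ J ∧
    (∀ s ∈ J, 0 < deriv τ s) ∧ τ '' J = I ∧ IsGeodesicOn m g (γ ∘ τ) J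

/-- The restrictions of `g` and `g'` to the `m`-dimensional submanifold `M` have the same geodesics,
considered as unparametrized curves. -/
def GeodesicallyEquivalent {n : ℕ} {M : Set (EuclideanSpace ℝ (Fin n))} (m : ℕ)
    (g g' : MetricNear M) : Prop :=
  ∀ (I : Set ℝ) (γ : ℝ → EuclideanSpace ℝ (Fin n)), IsOpen I → I.OrdConnected →
    (IsUnparametrizedGeodesicOn m g γ I ↔ IsUnparametrizedGeodesicOn m g' γ I)

/-- The ellipsoid `∑ (xⁱ)² / aᵢ = 1`. -/
def ellipsoid {n : ℕ} (a : Fin n → ℝ) : Set (EuclideanSpace ℝ (Fin n)) :=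
  {x | ∑ i, x i ^ 2 / a i = 1}

/-- The Euclidean metric `∑ (dxⁱ)²`. -/
def euclideanMetric {n : ℕ} (M : Set (EuclideanSpace ℝ (Fin n))) : MetricNear M where
  form _ := ∑ i, (EuclideanSpace.proj i : EuclideanSpace ℝ (Fin n) →L[ℝ] ℝ).smulRight
    (EuclideanSpace.proj i : EuclideanSpace ℝ (Fin n) →L[ℝ] ℝ)
  smooth _ _ := contDiffAt_const
  symm x _ v w := by simp [mul_comm]
  pos x _ v hv := by
    obtain ⟨i, hi⟩ : ∃ i, v i ≠ 0 := by
      by_contra! h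
      exact hv (by ext i; simpa using h i)
    simp only [sum_apply, ContinuousLinearMap.smulRight_apply, smul_apply, PiLp.proj_apply,
      smul_eq_mul]
    exact Finset.sum_pos' (fun j _ => mul_self_nonneg _)
      ⟨i, Finset.mem_univ i, mul_self_pos.2 hi⟩

theorem sum_sq_pos_of_mem_ellipsoid {n : ℕ} {a : Fin n → ℝ} (ha : ∀ i, 0 < a i)
    {x : EuclideanSpace ℝ (Fin n)} (hx : x ∈ ellipsoid a) : 0 < ∑ i, (x i / a i) ^ 2 := by
  obtain ⟨i, hi⟩ : ∃ i, x i ≠ 0 := by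
    by_contra! h
    simp [ellipsoid, h] at hx
  exact Finset.sum_pos' (fun j _ => sq_nonneg _)
    ⟨i, Finset.mem_univ i, by have := ha i; positivity⟩

theorem contDiffAt_smul_vector {E F : Type*} [NormedAddCommGroup E] [NormedSpace ℝ E]
    [NormedAddCommGroup F] [NormedSpace ℝ F] {f : E → ℝ} {x : E} (hf : ContDiffAt ℝ ∞ f x) (B : F) :
    ContDiffAt ℝ ∞ (fun y => f y • B) x :=
  hf.smul contDiffAt_const

/-- The metric `(∑ (xⁱ / aᵢ)²)⁻¹ ∑ (dxⁱ)² / aᵢ` near the ellipsoid. -/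
def ellipsoidMetric {n : ℕ} (a : Fin n → ℝ) (ha : ∀ i, 0 < a i) : MetricNear (ellipsoid a) where
  form x := (∑ i, (x i / a i) ^ 2)⁻¹ •
    ∑ i, (a i)⁻¹ • (EuclideanSpace.proj i : EuclideanSpace ℝ (Fin n) →L[ℝ] ℝ).smulRight
      (EuclideanSpace.proj i : EuclideanSpace ℝ (Fin n) →L[ℝ] ℝ)
  smooth x hx := by
    have h : ContDiffAt ℝ ∞ (fun y : EuclideanSpace ℝ (Fin n) => ∑ i, (y i / a i) ^ 2) x :=
      ContDiffAt.sum fun i _ => ContDiffAt.pow (ContDiffAt.div_const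
        (EuclideanSpace.proj i : EuclideanSpace ℝ (Fin n) →L[ℝ] ℝ).contDiff.contDiffAt _) 2
    exact contDiffAt_smul_vector (h.inv (sum_sq_pos_of_mem_ellipsoid ha hx).ne') _
  symm x _ v w := by simp [mul_comm]
  pos x hx v hv := by
    obtain ⟨i, hi⟩ : ∃ i, v i ≠ 0 := by
      by_contra! h
      exact hv (by ext i; simpa using h i)
    simp only [sum_apply, ContinuousLinearMap.smulRight_apply, smul_apply, PiLp.proj_apply,
      smul_eq_mul]
    refine mul_pos (inv_pos.2 (sum_sq_pos_of_mem_ellipsoid ha hx)) ?_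
    exact Finset.sum_pos'
      (fun j _ => mul_nonneg (inv_nonneg.2 (ha j).le) (mul_self_nonneg _))
      ⟨i, Finset.mem_univ i, mul_pos (inv_pos.2 (ha i)) (mul_self_pos.2 hi)⟩

end

/-! Let ν = (xⁱ/aᵢ) be the normal vector of the ellipsoid, f = |ν|², and let p, q be the velocity
and acceleration of a curve on it. Differentiating the equation of the ellipsoid twice gives ⟨ν, p⟩
= 0 and ⟨ν, q⟩ = -Q with Q = ∑ (pⁱ)²/aᵢ. A Euclidean geodesic has q parallel to ν, hence q = -(Q/f)
ν. For the second metric the Euler-Lagrange covector, up to the factor 1/f, has components qⁱ/aᵢ -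
(f'/f) pⁱ/aᵢ + (Q/f) xⁱ/aᵢ², and it must be a multiple of ν. Multiplying by aᵢ gives q = (f'/f) p -
(Q/f) ν + r x, and pairing with ν forces r = 0. The two equations (`EllipsoidEq` with δ = 0 and δ =
1) thus differ only by a multiple of the velocity, which a change of parameter absorbs: σ' = f in
one direction, σ' = 1/f in the other.

`geodesicEq_iff_eulerLagrange` trades Christoffel symbols for an ambient equation tested on tangent
vectors; `eulerLagrange_euclideanMetric_iff` and `eulerLagrange_ellipsoidMetric_iff` solve it for q;
`exists_reparametrization` and `EllipsoidEq.reparametrize` change the parameter. -/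

/-! ### Changes of parameter -/

/-- On an open interval, the autonomous equation `σ' = ρ(σ)` with `ρ` smooth and positive has a
smooth solution on an open interval which sweeps out the whole of the given interval. -/
theorem exists_reparametrization {J : Set ℝ} (hJ : IsOpen J) (hJc : J.OrdConnected) {ρ : ℝ → ℝ}
    (hρ : ContDiffOn ℝ ∞ ρ J) (hpos : ∀ t ∈ J, 0 < ρ t) :
    ∃ (K : Set ℝ) (σ : ℝ → ℝ), IsOpen K ∧ K.OrdConnected ∧ ContDiffOn ℝ ∞ σ K ∧ σ '' K = J ∧
      ∀ s ∈ K, HasDerivAt σ (ρ (σ s)) s := by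
  rcases J.eq_empty_or_nonempty with rfl | ⟨t₀, ht₀⟩
  · exact ⟨∅, id, isOpen_empty, Set.ordConnected_empty, by simp, by simp, by simp⟩
  have hinv : ContDiffOn ℝ ∞ (fun t => (ρ t)⁻¹) J := hρ.inv fun t ht => (hpos t ht).ne'
  -- Separation of variables: `S` is the time taken from `t₀` to `t` at speed `ρ`, and the solution
  -- is its inverse.
  set S : ℝ → ℝ := fun t => ∫ r in t₀..t, (ρ r)⁻¹ with hS
  have hder : ∀ t ∈ J, HasDerivAt S (ρ t)⁻¹ t := by
    intro t ht
    have hsub : Set.uIcc t₀ t ⊆ J := hJc.uIcc_subset ht₀ ht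
    refine intervalIntegral.integral_hasDerivAt_right
      (hinv.continuousOn.mono hsub).intervalIntegrable ?_
      (hinv.continuousOn.continuousAt (hJ.mem_nhds ht))
    exact hinv.continuousOn.stronglyMeasurableAtFilter hJ t ht
  have hSs : ContDiffOn ℝ ∞ S J := by
    rw [contDiffOn_infty_iff_deriv_of_isOpen hJ]
    exact ⟨fun t ht => (hder t ht).differentiableAt.differentiableWithinAt,
      hinv.congr fun t ht => (hder t ht).deriv⟩
  have hmono : StrictMonoOn S J := by
    refine strictMonoOn_of_deriv_pos hJc.convex hSs.continuousOn fun t ht => ?_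
    have ht := interior_subset ht
    rw [(hder t ht).deriv]
    exact inv_pos.2 (hpos t ht)
  have hstrict : ∀ t ∈ J, HasStrictDerivAt S (ρ t)⁻¹ t := fun t ht =>
    (hSs.contDiffAt (hJ.mem_nhds ht)).hasStrictDerivAt' (hder t ht) (by simp)
  -- A nonzero strict derivative makes `S` open, which yields the continuity of the inverse.
  have hopen : ∀ V ⊆ J, IsOpen V → IsOpen (S '' V) := by
    intro V hVJ hV
    rw [isOpen_iff_mem_nhds]
    rintro _ ⟨t, ht, rfl⟩
    rw [← (hstrict t (hVJ ht)).map_nhds_eq (inv_pos.2 (hpos t (hVJ ht))).ne']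
    exact Filter.image_mem_map (hV.mem_nhds ht)
  set σ := Function.invFunOn S J with hσ
  have hleft : ∀ t ∈ J, σ (S t) = t := fun t ht => hmono.injOn.leftInvOn_invFunOn ht
  have hcont : ∀ t ∈ J, ContinuousAt σ (S t) := by
    intro t ht
    rw [ContinuousAt, hleft t ht]
    intro V hV
    obtain ⟨W, hWV, hWo, hW⟩ := mem_nhds_iff.1 (Filter.inter_mem hV (hJ.mem_nhds ht))
    rw [Filter.mem_map]
    refine Filter.mem_of_superset
      ((hopen W (fun r hr => (hWV hr).2) hWo).mem_nhds ⟨t, hW, rfl⟩) ?_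
    rintro _ ⟨r, hr, rfl⟩
    rw [Set.mem_preimage, hleft r (hWV hr).2]
    exact (hWV hr).1
  have hKo : IsOpen (S '' J) := hopen J subset_rfl hJ
  have hσd : ∀ s ∈ S '' J, HasDerivAt σ (ρ (σ s)) s := by
    rintro _ ⟨t, ht, rfl⟩
    have h : HasDerivAt σ ((ρ t)⁻¹)⁻¹ (S t) := by
      refine HasDerivAt.of_local_left_inverse (f := S) (hcont t ht) ?_
        (inv_pos.2 (hpos t ht)).ne' ?_
      · rw [hleft t ht]; exact hder t ht
      · filter_upwards [hKo.mem_nhds ⟨t, ht, rfl⟩]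
        rintro _ ⟨r, hr, rfl⟩
        rw [hleft r hr]
    rw [inv_inv] at h
    rwa [hleft t ht]
  have hmaps : Set.MapsTo σ (S '' J) J := by
    rintro _ ⟨r, hr, rfl⟩
    rwa [hleft r hr]
  refine ⟨S '' J, σ, hKo, ?_, ?_, ?_, hσd⟩
  · exact (hJc.isPreconnected.image S hSs.continuousOn).ordConnected
  · rw [contDiffOn_infty]
    intro k
    -- Bootstrap: if σ is of class Cᵏ, so is σ' = ρ ∘ σ, and σ is of class Cᵏ⁺¹.
    induction k with
    | zero =>
      exact contDiffOn_zero.2 fun s hs => (hσd s hs).continuousAt.continuousWithinAt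
    | succ k ih =>
      push_cast
      rw [contDiffOn_succ_iff_deriv_of_isOpen hKo]
      refine ⟨fun s hs => (hσd s hs).differentiableAt.differentiableWithinAt, by simp, ?_⟩
      exact (((hρ.of_le (by exact_mod_cast le_top)).comp ih hmaps).congr
        fun s hs => (hσd s hs).deriv)
  · rw [Set.image_image]
    exact (Set.image_congr hleft).trans (Set.image_id' J)

theorem ContDiffAt.deriv_right_infty {E : Type*} [NormedAddCommGroup E] [NormedSpace ℝ E]
    {c : ℝ → E} {t : ℝ} (hc : ContDiffAt ℝ ∞ c t) : ContDiffAt ℝ ∞ (deriv c) t :=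
  (hc.fderiv_right (m := ∞) (by simp)).clm_apply contDiffAt_const

/-- The second derivative of a reparametrized curve. -/
theorem deriv_deriv_comp {E : Type*} [NormedAddCommGroup E] [NormedSpace ℝ E] {c : ℝ → E}
    {σ ρ : ℝ → ℝ} {s ρ' : ℝ} (hc : ContDiffAt ℝ ∞ c (σ s))
    (hσ : ∀ᶠ r in nhds s, HasDerivAt σ (ρ (σ r)) r) (hρ : HasDerivAt ρ ρ' (σ s)) :
    deriv (c ∘ σ) s = ρ (σ s) • deriv c (σ s) ∧
    deriv (deriv (c ∘ σ)) s =
      ρ (σ s) ^ 2 • deriv (deriv c) (σ s) + (ρ' * ρ (σ s)) • deriv c (σ s) := by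
  have hev : ∀ᶠ r in nhds s, DifferentiableAt ℝ c (σ r) :=
    (hσ.self_of_nhds.continuousAt.eventually
      ((hc.of_le (m := 1) (by simp)).eventually (by simp))).mono
      fun r hr => hr.differentiableAt (by simp)
  have h1 : deriv (c ∘ σ) =ᶠ[nhds s] fun r => ρ (σ r) • deriv c (σ r) := by
    filter_upwards [hσ, hev] with r hr hd
    exact (hd.hasDerivAt.scomp r hr).deriv
  have hdc : HasDerivAt (deriv c) (deriv (deriv c) (σ s)) (σ s) := by
    exact (hc.deriv_right_infty.differentiableAt (by simp)).hasDerivAt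
  refine ⟨h1.self_of_nhds, ?_⟩
  rw [h1.deriv_eq]
  have := (hρ.comp s hσ.self_of_nhds).smul (hdc.scomp s hσ.self_of_nhds)
  refine this.deriv.trans ?_
  simp [smul_smul, pow_two]

/-! ### The geodesic equation as an ambient Euler-Lagrange equation -/

noncomputable section

/-- The Euler-Lagrange expression
`g(q, w) + (∂ₚ g)(p, w) - ½ (∂_w g)(p, p)` of the energy of `g`, evaluated on a curve with
velocity `p` and acceleration `q` at `x`, in the direction `w`. -/
def MetricNear.eulerLagrange {n : ℕ} {M : Set (EuclideanSpace ℝ (Fin n))} (g : MetricNear M)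
    (x p q w : EuclideanSpace ℝ (Fin n)) : ℝ :=
  g.form x q w + fderiv ℝ g.form x p p w - (1 / 2) * fderiv ℝ g.form x w p p

/-- `MetricNear.eulerLagrange` as a linear form in the direction. -/
def MetricNear.eulerLagrangeₗ {n : ℕ} {M : Set (EuclideanSpace ℝ (Fin n))} (g : MetricNear M)
    (x p q : EuclideanSpace ℝ (Fin n)) : EuclideanSpace ℝ (Fin n) →ₗ[ℝ] ℝ where
  toFun := g.eulerLagrange x p q
  map_add' v w := by simp only [eulerLagrange, map_add, add_apply]; ring
  map_smul' r v := by
    simp only [eulerLagrange, map_smul, smul_apply, smul_eq_mul, RingHom.id_apply]; ring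

/-- Lowers the index of the geodesic equation, removing the inverse metric hidden in the Christoffel
symbols. -/
theorem add_inv_mulVec_eq_zero_iff {m : ℕ} {A : Matrix (Fin m) (Fin m) ℝ} (hA : IsUnit A)
    (q b : Fin m → ℝ) :
    (∀ k, q k + ∑ l, A⁻¹ k l * b l = 0) ↔ ∀ l, A.mulVec q l + b l = 0 := by
  have hdet := (Matrix.isUnit_iff_isUnit_det _).1 hA
  constructor
  · intro h l
    have h' : q = - A⁻¹.mulVec b := funext fun k => eq_neg_of_add_eq_zero_left (h k)
    rw [h', Matrix.mulVec_neg, Matrix.mulVec_mulVec, Matrix.mul_nonsing_inv _ hdet,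
      Matrix.one_mulVec]
    simp
  · intro h k
    have h' : b = - A.mulVec q := funext fun l => eq_neg_of_add_eq_zero_right (h l)
    change q k + A⁻¹.mulVec b k = 0
    rw [h', Matrix.mulVec_neg, Matrix.mulVec_mulVec, Matrix.nonsing_inv_mul _ hdet,
      Matrix.one_mulVec]
    simp

theorem sum_sum_single_mul_mul {m : ℕ}
    (B : EuclideanSpace ℝ (Fin m) →ₗ[ℝ] EuclideanSpace ℝ (Fin m) →ₗ[ℝ] ℝ)
    (p : EuclideanSpace ℝ (Fin m)) :
    ∑ i, ∑ j, B (EuclideanSpace.single i 1) (EuclideanSpace.single j 1) * p i * p j = B p p := by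
  have hp : p = ∑ i, p i • EuclideanSpace.single i (1 : ℝ) := by
    ext j
    simp [Pi.single_apply]
  conv_rhs => rw [hp]
  simp only [map_sum, map_smul, LinearMap.sum_apply, LinearMap.smul_apply, smul_eq_mul,
    Finset.mul_sum]
  rw [Finset.sum_comm]
  exact Finset.sum_congr rfl fun i _ => Finset.sum_congr rfl fun j _ => by ring

namespace LocalParametrization

variable {n m : ℕ} {M : Set (EuclideanSpace ℝ (Fin n))}

theorem contDiffAt (P : LocalParametrization M m) {u : EuclideanSpace ℝ (Fin m)}
    (hu : u ∈ P.source) : ContDiffAt ℝ ∞ P.toFun u :=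
  P.smooth.contDiffAt (P.open_source.mem_nhds hu)

theorem mem (P : LocalParametrization M m) {u : EuclideanSpace ℝ (Fin m)}
    (hu : u ∈ P.source) : P.toFun u ∈ M := by
  obtain ⟨W, _, h⟩ := P.open_image P.source subset_rfl P.open_source
  exact (h ▸ Set.mem_image_of_mem P.toFun hu).2

theorem differentiableAt_fderiv (P : LocalParametrization M m) {u : EuclideanSpace ℝ (Fin m)}
    (hu : u ∈ P.source) : DifferentiableAt ℝ (fderiv ℝ P.toFun) u :=
  ((P.contDiffAt hu).fderiv_right (m := ∞) (by simp)).differentiableAt (by simp)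

/-- The derivative in the direction `a` of the pulled back metric, evaluated on `b` and `c`. -/
def pullbackDeriv (P : LocalParametrization M m) (g : MetricNear M)
    (u a b c : EuclideanSpace ℝ (Fin m)) : ℝ :=
  fderiv ℝ g.form (P.toFun u) (fderiv ℝ P.toFun u a) (fderiv ℝ P.toFun u b) (fderiv ℝ P.toFun u c)
    + g.form (P.toFun u) (fderiv ℝ (fderiv ℝ P.toFun) u a b) (fderiv ℝ P.toFun u c)
    + g.form (P.toFun u) (fderiv ℝ P.toFun u b) (fderiv ℝ (fderiv ℝ P.toFun) u a c)

theorem coeffDeriv_eq (P : LocalParametrization M m) (g : MetricNear M)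
    {u : EuclideanSpace ℝ (Fin m)} (hu : u ∈ P.source) (k i j : Fin m) :
    P.coeffDeriv g u k i j = P.pullbackDeriv g u (EuclideanSpace.single k 1)
      (EuclideanSpace.single i 1) (EuclideanSpace.single j 1) := by
  have hφ := ((P.contDiffAt hu).differentiableAt (by simp)).hasFDerivAt
  have hG := ((g.smooth _ (P.mem hu)).differentiableAt (by simp)).hasFDerivAt
  have hD := (P.differentiableAt_fderiv hu).hasFDerivAt
  have hc : ∀ i, HasFDerivAt (fun v => fderiv ℝ P.toFun v (EuclideanSpace.single i 1)) _ u :=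
    fun i => hD.clm_apply (hasFDerivAt_const (EuclideanSpace.single i (1 : ℝ)) u)
  have h := ((hG.comp u hφ).clm_apply (hc i)).clm_apply (hc j)
  unfold coeffDeriv coeff tangentVec
  simp only [Matrix.of_apply]
  refine (congrArg (fun L => L (EuclideanSpace.single k (1 : ℝ))) h.fderiv).trans ?_
  simp [pullbackDeriv]
  ring

/-- Contracted twice with `p`, the terms ∂ᵢh_{jl} and ∂ⱼh_{il} contribute equally, so the factor ½
survives only on ∂ₗh_{ij}. -/
theorem sum_christoffel (P : LocalParametrization M m) (g : MetricNear M)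
    {u : EuclideanSpace ℝ (Fin m)} (hu : u ∈ P.source) (p : EuclideanSpace ℝ (Fin m))
    (k : Fin m) :
    ∑ i, ∑ j, P.christoffel g u k i j * p i * p j =
      ∑ l, (P.coeff g u)⁻¹ k l * (P.pullbackDeriv g u p p (EuclideanSpace.single l 1) -
        (1 / 2) * P.pullbackDeriv g u (EuclideanSpace.single l 1) p p) := by
  have h1 : ∀ c, ∑ i, ∑ j, P.pullbackDeriv g u (EuclideanSpace.single i 1)
      (EuclideanSpace.single j 1) c * p i * p j = P.pullbackDeriv g u p p c := fun c =>
    sum_sum_single_mul_mul (LinearMap.mk₂ ℝ (fun a b => P.pullbackDeriv g u a b c)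
      (by intros; simp [pullbackDeriv]; ring) (by intros; simp [pullbackDeriv]; ring)
      (by intros; simp [pullbackDeriv]; ring) (by intros; simp [pullbackDeriv]; ring)) p
  have h2 : ∀ a, ∑ i, ∑ j, P.pullbackDeriv g u a (EuclideanSpace.single i 1)
      (EuclideanSpace.single j 1) * p i * p j = P.pullbackDeriv g u a p p := fun a =>
    sum_sum_single_mul_mul (LinearMap.mk₂ ℝ (fun b c => P.pullbackDeriv g u a b c)
      (by intros; simp [pullbackDeriv]; ring) (by intros; simp [pullbackDeriv]; ring)
      (by intros; simp [pullbackDeriv]; ring) (by intros; simp [pullbackDeriv]; ring)) p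
  have h3 : ∀ c, ∑ i, ∑ j, P.pullbackDeriv g u (EuclideanSpace.single j 1)
      (EuclideanSpace.single i 1) c * p i * p j = P.pullbackDeriv g u p p c := fun c => by
    rw [← h1, Finset.sum_comm]
    exact Finset.sum_congr rfl fun i _ => Finset.sum_congr rfl fun j _ => by ring
  have h4 : ∀ l, P.pullbackDeriv g u p p (EuclideanSpace.single l 1) -
        (1 / 2) * P.pullbackDeriv g u (EuclideanSpace.single l 1) p p =
      ∑ i, ∑ j, (1 / 2) * (P.coeffDeriv g u i j l + P.coeffDeriv g u j i l -
        P.coeffDeriv g u l i j) * p i * p j := by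
    intro l
    simp only [P.coeffDeriv_eq g hu, mul_sub, mul_add, sub_mul, add_mul, Finset.sum_sub_distrib,
      Finset.sum_add_distrib, mul_assoc, ← Finset.mul_sum]
    simp only [← mul_assoc, h1, h2, h3]
    ring
  simp only [h4, christoffel, Finset.mul_sum, Finset.sum_mul]
  conv_rhs => rw [Finset.sum_comm]
  refine Finset.sum_congr rfl fun i _ => ?_
  conv_rhs => rw [Finset.sum_comm]
  exact Finset.sum_congr rfl fun j _ => Finset.sum_congr rfl fun l _ => by ring

theorem coeff_mulVec (P : LocalParametrization M m) (g : MetricNear M)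
    (u z : EuclideanSpace ℝ (Fin m)) (l : Fin m) : (P.coeff g u).mulVec z l =
      g.form (P.toFun u) (P.tangentVec u l) (fderiv ℝ P.toFun u z) := by
  have hz : z = ∑ i, z i • EuclideanSpace.single i (1 : ℝ) := by
    ext j
    simp [Pi.single_apply]
  conv_rhs => rw [hz]
  simp only [map_sum, map_smul, Matrix.mulVec, dotProduct, coeff, Matrix.of_apply, tangentVec,
    smul_eq_mul]
  exact Finset.sum_congr rfl fun i _ => by ring

/-- For `z` in the kernel, the image of `z` under the derivative of the parametrization has length
zero; positivity and the immersion property give z = 0. -/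
theorem isUnit_coeff (P : LocalParametrization M m) (g : MetricNear M)
    {u : EuclideanSpace ℝ (Fin m)} (hu : u ∈ P.source) : IsUnit (P.coeff g u) := by
  rw [← Matrix.mulVec_injective_iff_isUnit]
  refine (injective_iff_map_eq_zero (P.coeff g u).mulVecLin).2 fun z hz => ?_
  have h0 : ∀ l, g.form (P.toFun u) (P.tangentVec u l)
      (fderiv ℝ P.toFun u (WithLp.toLp 2 z)) = 0 := fun l => by
    rw [← P.coeff_mulVec]
    exact congrFun hz l
  have hz : WithLp.toLp 2 z = ∑ i, z i • EuclideanSpace.single i (1 : ℝ) := by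
    ext j
    simp [Pi.single_apply]
  have h1 : g.form (P.toFun u) (fderiv ℝ P.toFun u (WithLp.toLp 2 z))
      (fderiv ℝ P.toFun u (WithLp.toLp 2 z)) = 0 := by
    conv_lhs => enter [1]; rw [hz]
    simp only [map_sum, map_smul, sum_apply, smul_apply]
    exact Finset.sum_eq_zero fun l _ => by
      rw [show fderiv ℝ P.toFun u (EuclideanSpace.single l 1) = P.tangentVec u l from rfl, h0,
        smul_zero]
  have h2 : fderiv ℝ P.toFun u (WithLp.toLp 2 z) = 0 := by
    by_contra hne
    exact (g.pos _ (P.mem hu) _ hne).ne' h1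
  have h3 : WithLp.toLp 2 z = 0 := P.immersion u hu (h2.trans (map_zero _).symm)
  simpa using congrArg WithLp.ofLp h3

/-- The velocity and the acceleration of a curve given in coordinates. -/
theorem deriv_comp (P : LocalParametrization M m) {u : ℝ → EuclideanSpace ℝ (Fin m)} {t : ℝ}
    (hu : u t ∈ P.source) (hut : ContDiffAt ℝ ∞ u t) :
    deriv (P.toFun ∘ u) t = fderiv ℝ P.toFun (u t) (deriv u t) ∧
    deriv (deriv (P.toFun ∘ u)) t =
      fderiv ℝ (fderiv ℝ P.toFun) (u t) (deriv u t) (deriv u t) +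
        fderiv ℝ P.toFun (u t) (deriv (deriv u) t) := by
  have hd : ∀ᶠ s in nhds t, DifferentiableAt ℝ u s :=
    ((hut.of_le (m := 1) (by simp)).eventually (by simp)).mono
      fun r hr => hr.differentiableAt (by simp)
  have hs : ∀ᶠ s in nhds t, u s ∈ P.source :=
    hut.continuousAt.eventually (P.open_source.mem_nhds hu)
  have h1 : deriv (P.toFun ∘ u) =ᶠ[nhds t] fun s => fderiv ℝ P.toFun (u s) (deriv u s) := by
    filter_upwards [hd, hs] with s hd hs
    exact (((P.contDiffAt hs).differentiableAt (by simp)).hasFDerivAt.comp_hasDerivAt s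
      hd.hasDerivAt).deriv
  refine ⟨h1.self_of_nhds, ?_⟩
  rw [h1.deriv_eq]
  exact (((P.differentiableAt_fderiv hu).hasFDerivAt.comp_hasDerivAt t
    hd.self_of_nhds.hasDerivAt).clm_apply
      (hut.deriv_right_infty.differentiableAt (by simp)).hasDerivAt).deriv

/-- Both sides are expanded by the product rule. The terms pairing the velocity with the mixed
second derivative in the directions `p` and eₗ cancel because second derivatives are symmetric. -/
theorem eulerLagrange_tangentVec (P : LocalParametrization M m) (g : MetricNear M)
    {u : EuclideanSpace ℝ (Fin m)} (hu : u ∈ P.source) (p q : EuclideanSpace ℝ (Fin m))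
    (l : Fin m) :
    g.eulerLagrange (P.toFun u) (fderiv ℝ P.toFun u p)
      (fderiv ℝ (fderiv ℝ P.toFun) u p p + fderiv ℝ P.toFun u q) (P.tangentVec u l) =
    (P.coeff g u).mulVec q l + (P.pullbackDeriv g u p p (EuclideanSpace.single l 1) -
      (1 / 2) * P.pullbackDeriv g u (EuclideanSpace.single l 1) p p) := by
  have hsymm := ((P.contDiffAt hu).isSymmSndFDerivAt
    (by
      rw [minSmoothness_of_isRCLikeNormedField]
      exact WithTop.coe_le_coe.2 (le_top : (2 : ℕ∞) ≤ ⊤))).eq p (EuclideanSpace.single l 1)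
  rw [coeff_mulVec, g.symm _ (P.mem hu) (P.tangentVec u l)]
  simp only [MetricNear.eulerLagrange, pullbackDeriv, tangentVec, map_add, add_apply, ← hsymm]
  rw [g.symm _ (P.mem hu) (fderiv ℝ (fderiv ℝ P.toFun) u p (EuclideanSpace.single l 1))]
  ring

theorem forall_eulerLagrange_iff (P : LocalParametrization M m) (g : MetricNear M)
    (u : EuclideanSpace ℝ (Fin m)) (x p q : EuclideanSpace ℝ (Fin n)) :
    (∀ z, g.eulerLagrange x p q (fderiv ℝ P.toFun u z) = 0) ↔
      ∀ l, g.eulerLagrange x p q (P.tangentVec u l) = 0 := by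
  refine ⟨fun h l => h _, fun h z => ?_⟩
  have hz : z = ∑ i, z i • EuclideanSpace.single i (1 : ℝ) := by
    ext j
    simp [Pi.single_apply]
  change g.eulerLagrangeₗ x p q (fderiv ℝ P.toFun u z) = 0
  rw [hz, map_sum, map_sum]
  refine Finset.sum_eq_zero fun l _ => ?_
  rw [map_smul, map_smul]
  exact (congrArg (z l • ·) (h l)).trans (smul_zero _)

theorem geodesicEq_iff_eulerLagrange (P : LocalParametrization M m) (g : MetricNear M)
    {u : EuclideanSpace ℝ (Fin m)} (hu : u ∈ P.source) (p q : EuclideanSpace ℝ (Fin m)) :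
    (∀ k, q k + ∑ i, ∑ j, P.christoffel g u k i j * p i * p j = 0) ↔
    ∀ z, g.eulerLagrange (P.toFun u) (fderiv ℝ P.toFun u p)
      (fderiv ℝ (fderiv ℝ P.toFun) u p p + fderiv ℝ P.toFun u q) (fderiv ℝ P.toFun u z) = 0 := by
  simp only [forall_eulerLagrange_iff, P.eulerLagrange_tangentVec g hu, P.sum_christoffel g hu]
  exact add_inv_mulVec_eq_zero_iff (P.isUnit_coeff g hu) q fun l =>
    P.pullbackDeriv g u p p (EuclideanSpace.single l 1) -
      (1 / 2) * P.pullbackDeriv g u (EuclideanSpace.single l 1) p p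

end LocalParametrization

end

/-! ### The ellipsoid and the geodesic equations of the two metrics -/

noncomputable section

/-- The squared length `∑ (xⁱ / aᵢ)²` of the normal vector of the ellipsoid. -/
def normalSq {n : ℕ} (a : Fin n → ℝ) (x : EuclideanSpace ℝ (Fin n)) : ℝ :=
  ∑ i, (x i / a i) ^ 2

/-- The derivative of `normalSq a` at `x` in the direction `p`. -/
def normalSqDeriv {n : ℕ} (a : Fin n → ℝ) (x p : EuclideanSpace ℝ (Fin n)) : ℝ :=
  2 * ∑ i, x i / a i * (p i / a i)

theorem hasFDerivAt_sum_mul_sq {n : ℕ} (b : Fin n → ℝ) (x : EuclideanSpace ℝ (Fin n)) :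
    HasFDerivAt (fun y : EuclideanSpace ℝ (Fin n) => ∑ i, b i * y i ^ 2)
      (∑ i, (2 * b i * x i) • (EuclideanSpace.proj i : EuclideanSpace ℝ (Fin n) →L[ℝ] ℝ)) x := by
  refine HasFDerivAt.fun_sum fun i _ => ?_
  have h := ((((EuclideanSpace.proj i : EuclideanSpace ℝ (Fin n) →L[ℝ] ℝ).hasFDerivAt
    (x := x)).pow 2).const_mul (b i))
  refine h.congr_fderiv ?_
  ext v
  simp
  ring

theorem hasFDerivAt_normalSq {n : ℕ} (a : Fin n → ℝ) (x : EuclideanSpace ℝ (Fin n)) :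
    HasFDerivAt (normalSq a) (∑ i, (2 * (a i)⁻¹ ^ 2 * x i) •
      (EuclideanSpace.proj i : EuclideanSpace ℝ (Fin n) →L[ℝ] ℝ)) x := by
  convert hasFDerivAt_sum_mul_sq (fun i => (a i)⁻¹ ^ 2) x using 1
  ext y
  exact Finset.sum_congr rfl fun i _ => by ring

theorem fderiv_normalSq_apply {n : ℕ} (a : Fin n → ℝ) (x p : EuclideanSpace ℝ (Fin n)) :
    fderiv ℝ (normalSq a) x p = normalSqDeriv a x p := by
  rw [(hasFDerivAt_normalSq a x).fderiv]
  simp only [sum_apply, smul_apply, PiLp.proj_apply, smul_eq_mul, normalSqDeriv, Finset.mul_sum]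
  exact Finset.sum_congr rfl fun i _ => by ring

theorem contDiff_normalSq {n : ℕ} (a : Fin n → ℝ) : ContDiff ℝ ∞ (normalSq a) :=
  ContDiff.sum fun i _ => ((EuclideanSpace.proj i : EuclideanSpace ℝ (Fin n) →L[ℝ] ℝ).contDiff
    |>.div_const _).pow 2

theorem normalSq_pos {n : ℕ} {a : Fin n → ℝ} (ha : ∀ i, 0 < a i)
    {x : EuclideanSpace ℝ (Fin n)} (hx : x ∈ ellipsoid a) : 0 < normalSq a x :=
  sum_sq_pos_of_mem_ellipsoid ha hx

/-- The linear form `w ↦ ∑ xⁱ wⁱ / aᵢ` whose kernel is the tangent space of the ellipsoid. -/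
def conormal {n : ℕ} (a : Fin n → ℝ) (x : EuclideanSpace ℝ (Fin n)) :
    EuclideanSpace ℝ (Fin n) →L[ℝ] ℝ :=
  ∑ i, (x i / a i) • (EuclideanSpace.proj i : EuclideanSpace ℝ (Fin n) →L[ℝ] ℝ)

theorem conormal_apply {n : ℕ} (a : Fin n → ℝ) (x w : EuclideanSpace ℝ (Fin n)) :
    conormal a x w = ∑ i, x i / a i * w i := by
  simp [conormal]

/-- The image of the derivative lies in the kernel of the conormal, and both have dimension n - 1.
-/
theorem LocalParametrization.exists_fderiv_eq_iff {n : ℕ} {a : Fin n → ℝ}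
    (P : LocalParametrization (ellipsoid a) (n - 1)) {u : EuclideanSpace ℝ (Fin (n - 1))}
    (hu : u ∈ P.source) (w : EuclideanSpace ℝ (Fin n)) :
    (∃ z, fderiv ℝ P.toFun u z = w) ↔ conormal a (P.toFun u) w = 0 := by
  set x := P.toFun u
  have hx : x ∈ ellipsoid a := P.mem hu
  have hle : LinearMap.range (fderiv ℝ P.toFun u).toLinearMap ≤
      LinearMap.ker (conormal a x).toLinearMap := by
    rintro _ ⟨z, rfl⟩
    have h1 := (hasFDerivAt_sum_mul_sq (fun i => (a i)⁻¹) x).comp u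
      ((P.contDiffAt hu).differentiableAt (by simp)).hasFDerivAt
    have h2 : (fun y : EuclideanSpace ℝ (Fin n) => ∑ i, (a i)⁻¹ * y i ^ 2) ∘ P.toFun =ᶠ[nhds u]
        fun _ => 1 := by
      filter_upwards [P.open_source.mem_nhds hu] with v hv
      rw [← show ∑ i, P.toFun v i ^ 2 / a i = 1 from P.mem hv]
      exact Finset.sum_congr rfl fun i _ => by ring
    have h3 := congrArg (fun L => L z)
      (h1.unique ((hasFDerivAt_const (1 : ℝ) u).congr_of_eventuallyEq h2))
    simp only [ContinuousLinearMap.comp_apply, sum_apply, smul_apply, PiLp.proj_apply,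
      smul_eq_mul, zero_apply] at h3
    simp only [LinearMap.mem_ker, ContinuousLinearMap.coe_coe, conormal_apply]
    have h4 : ∑ i, 2 * (x i / a i * fderiv ℝ P.toFun u z i) = 0 := by
      rw [← h3]
      exact Finset.sum_congr rfl fun i _ => by ring
    rw [← Finset.mul_sum] at h4
    linarith
  have hne : (conormal a x).toLinearMap ≠ 0 := by
    intro h
    have h1 : conormal a x x = 0 := congrArg (fun L => L x) h
    have h2 : conormal a x x = 1 := by
      rw [conormal_apply, ← show ∑ i, x i ^ 2 / a i = 1 from hx]
      exact Finset.sum_congr rfl fun i _ => by ring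
    linarith
  have hker := Module.Dual.finrank_ker_add_one_of_ne_zero hne
  have hrange := LinearMap.finrank_range_of_inj (f := (fderiv ℝ P.toFun u).toLinearMap)
    (P.immersion u hu)
  rw [finrank_euclideanSpace_fin] at hker hrange
  -- `hker` forces n ≥ 1, so the truncated subtraction n - 1 is harmless.
  have heq := Submodule.eq_of_le_of_finrank_eq hle (by rw [hrange]; omega)
  exact (SetLike.ext_iff.1 heq w)

theorem HasDerivAt.euclideanSpace_apply {n : ℕ} {c : ℝ → EuclideanSpace ℝ (Fin n)}
    {p : EuclideanSpace ℝ (Fin n)} {t : ℝ} (h : HasDerivAt c p t) (i : Fin n) :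
    HasDerivAt (fun s => c s i) (p i) t :=
  (EuclideanSpace.proj i : EuclideanSpace ℝ (Fin n) →L[ℝ] ℝ).hasFDerivAt.comp_hasDerivAt t h

/-- The first and the second derivative of the equation of the ellipsoid along a curve. -/
theorem conormal_deriv_of_mem_ellipsoid {n : ℕ} {a : Fin n → ℝ}
    {c : ℝ → EuclideanSpace ℝ (Fin n)} {t : ℝ} (hc : ContDiffAt ℝ ∞ c t)
    (hM : ∀ᶠ s in nhds t, c s ∈ ellipsoid a) :
    conormal a (c t) (deriv c t) = 0 ∧
    conormal a (c t) (deriv (deriv c) t) = - ∑ i, deriv c t i ^ 2 / a i := by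
  have hd : ∀ᶠ s in nhds t, DifferentiableAt ℝ c s :=
    ((hc.of_le (m := 1) (by simp)).eventually (by simp)).mono
      fun r hr => hr.differentiableAt (by simp)
  have h1 : (fun s => conormal a (c s) (deriv c s)) =ᶠ[nhds t] fun _ => 0 := by
    filter_upwards [hM.eventually_nhds, hd] with s hs hd
    have h := HasDerivAt.fun_sum (u := Finset.univ) fun i _ =>
      ((hd.hasDerivAt.euclideanSpace_apply i).fun_pow 2).div_const (a i)
    have h0 := h.unique ((hasDerivAt_const s (1 : ℝ)).congr_of_eventuallyEq hs)
    have h4 : ∑ i, 2 * (c s i / a i * deriv c s i) = 0 := by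
      rw [← h0]
      exact Finset.sum_congr rfl fun i _ => by push_cast; ring
    rw [← Finset.mul_sum] at h4
    rw [conormal_apply]
    linarith
  refine ⟨h1.self_of_nhds, ?_⟩
  simp only [conormal_apply] at h1 ⊢
  have h := HasDerivAt.fun_sum (u := Finset.univ) fun i _ =>
    ((hd.self_of_nhds.hasDerivAt.euclideanSpace_apply i).div_const (a i)).fun_mul
      ((hc.deriv_right_infty.differentiableAt (by simp)).hasDerivAt.euclideanSpace_apply i)
  have h0 := h.unique ((hasDerivAt_const t (0 : ℝ)).congr_of_eventuallyEq h1)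
  rw [Finset.sum_add_distrib] at h0
  rw [← neg_eq_of_add_eq_zero_right h0]
  exact congrArg _ (Finset.sum_congr rfl fun i _ => by ring)

/-- A Lagrange multiplier: the test vector is the part of `y` orthogonal to ν, whose squared length
must then vanish. -/
theorem forall_sum_mul_eq_zero_iff {n : ℕ} {a : Fin n → ℝ} (ha : ∀ i, 0 < a i)
    {x : EuclideanSpace ℝ (Fin n)} (hx : x ∈ ellipsoid a) (y : Fin n → ℝ) :
    (∀ w, conormal a x w = 0 → ∑ i, y i * w i = 0) ↔ ∃ r : ℝ, ∀ i, y i = r * (x i / a i) := by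
  have hf := (normalSq_pos ha hx).ne'
  constructor
  · intro h
    set r := (∑ i, x i / a i * y i) / normalSq a x with hr
    have h0 : ∑ i, x i / a i * (y i - r * (x i / a i)) = 0 := by
      have : ∑ i, x i / a i * (y i - r * (x i / a i)) =
          ∑ i, x i / a i * y i - r * normalSq a x := by
        rw [normalSq, Finset.mul_sum, ← Finset.sum_sub_distrib]
        exact Finset.sum_congr rfl fun i _ => by ring
      rw [this, hr, div_mul_cancel₀ _ hf, sub_self]
    have h1 : ∑ i, y i * (y i - r * (x i / a i)) = 0 :=
      h (WithLp.toLp 2 fun i => y i - r * (x i / a i)) (by rw [conormal_apply]; exact h0)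
    have h2 : ∑ i, (y i - r * (x i / a i)) ^ 2 = 0 := by
      have : ∑ i, (y i - r * (x i / a i)) ^ 2 = ∑ i, y i * (y i - r * (x i / a i)) -
          r * ∑ i, x i / a i * (y i - r * (x i / a i)) := by
        rw [Finset.mul_sum, ← Finset.sum_sub_distrib]
        exact Finset.sum_congr rfl fun i _ => by ring
      rw [this, h0, h1, mul_zero, sub_zero]
    refine ⟨r, fun i => sub_eq_zero.1 (pow_eq_zero_iff (two_ne_zero)|>.1 ?_)⟩
    exact (Finset.sum_eq_zero_iff_of_nonneg fun i _ => sq_nonneg _).1 h2 i (Finset.mem_univ i)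
  · rintro ⟨r, hr⟩ w hw
    rw [conormal_apply] at hw
    rw [← mul_zero r, ← hw, Finset.mul_sum]
    exact Finset.sum_congr rfl fun i _ => by rw [hr]; ring

/-- The equation `q = δ (f' / f) p - (∑ (pⁱ)² / aᵢ / f) ν` on the acceleration `q` of a curve on the
ellipsoid, where `p` is its velocity, `ν` the normal vector, and `f = |ν|²`. -/
def EllipsoidEq {n : ℕ} (a : Fin n → ℝ) (δ : ℝ) (x p q : EuclideanSpace ℝ (Fin n)) : Prop :=
  ∀ i, q i = δ * (normalSqDeriv a x p / normalSq a x) * p i -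
    (∑ j, p j ^ 2 / a j) / normalSq a x * (x i / a i)

theorem eulerLagrange_euclideanMetric_iff {n : ℕ} {a : Fin n → ℝ} (ha : ∀ i, 0 < a i)
    {x p q : EuclideanSpace ℝ (Fin n)} (hx : x ∈ ellipsoid a)
    (hq : conormal a x q = - ∑ i, p i ^ 2 / a i) :
    (∀ w, conormal a x w = 0 →
      (euclideanMetric (ellipsoid a)).eulerLagrange x p q w = 0) ↔ EllipsoidEq a 0 x p q := by
  have hf := (normalSq_pos ha hx).ne'
  have hE : ∀ w, (euclideanMetric (ellipsoid a)).eulerLagrange x p q w = ∑ i, q i * w i := by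
    intro w
    simp [MetricNear.eulerLagrange, euclideanMetric, mul_comm]
  simp only [hE, forall_sum_mul_eq_zero_iff ha hx, EllipsoidEq, zero_mul, zero_sub]
  refine ⟨?_, fun h => ⟨_, fun i => (h i).trans (neg_mul _ _).symm⟩⟩
  rintro ⟨r, hr⟩ i
  have h1 : r * normalSq a x = - ∑ i, p i ^ 2 / a i := by
    rw [← hq, conormal_apply, normalSq, Finset.mul_sum]
    exact Finset.sum_congr rfl fun i _ => by rw [hr]; ring
  rw [hr, ← neg_mul, ← neg_div, ← h1, mul_div_cancel_right₀ _ hf]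

theorem fderiv_inv_smul_const {E F : Type*} [NormedAddCommGroup E] [NormedSpace ℝ E]
    [NormedAddCommGroup F] [NormedSpace ℝ F] {f : E → ℝ} {x : E} (hf : DifferentiableAt ℝ f x)
    (h0 : f x ≠ 0) (B : F) (v : E) :
    fderiv ℝ (fun y => (f y)⁻¹ • B) x v = (-(fderiv ℝ f x v) / f x ^ 2) • B := by
  have h := ((hasDerivAt_inv h0).comp_hasFDerivAt x hf.hasFDerivAt).smul_const B
  have h' : fderiv ℝ (fun y => (f y)⁻¹ • B) x = _ := h.fderiv
  rw [h', ContinuousLinearMap.smulRight_apply, smul_apply, smul_eq_mul, neg_mul, neg_div,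
    inv_mul_eq_div]

theorem ellipsoidMetric_form_apply {n : ℕ} {a : Fin n → ℝ} (ha : ∀ i, 0 < a i)
    (x v w : EuclideanSpace ℝ (Fin n)) :
    (ellipsoidMetric a ha).form x v w = (normalSq a x)⁻¹ * ∑ i, v i * w i / a i := by
  simp only [ellipsoidMetric, normalSq, smul_apply, sum_apply, ContinuousLinearMap.smulRight_apply,
    PiLp.proj_apply, smul_eq_mul]
  exact congrArg _ (Finset.sum_congr rfl fun i _ => by ring)

/-- The metric depends on the point only through 1/f. Its derivative along `p` gives the f'/f term,
and the one along `w`, where f'(w) = 2 ∑ xⁱwⁱ/aᵢ², gives the last term. -/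
theorem eulerLagrange_ellipsoidMetric {n : ℕ} {a : Fin n → ℝ} (ha : ∀ i, 0 < a i)
    {x : EuclideanSpace ℝ (Fin n)} (hx : x ∈ ellipsoid a) (p q w : EuclideanSpace ℝ (Fin n)) :
    (ellipsoidMetric a ha).eulerLagrange x p q w = (normalSq a x)⁻¹ *
      ∑ i, (q i / a i - normalSqDeriv a x p / normalSq a x * (p i / a i) +
        (∑ j, p j ^ 2 / a j) / normalSq a x * (x i / a i ^ 2)) * w i := by
  have hf := (normalSq_pos ha hx).ne'
  have hd : ∀ v b c, fderiv ℝ (ellipsoidMetric a ha).form x v b c =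
      -(normalSqDeriv a x v) / normalSq a x ^ 2 * ∑ i, b i * c i / a i := by
    intro v b c
    have hG := (((ellipsoidMetric a ha).smooth x hx).differentiableAt (by simp)).hasFDerivAt
    have h1 := (hG.clm_apply (hasFDerivAt_const b x)).clm_apply (hasFDerivAt_const c x)
    have h2 := fderiv_inv_smul_const (hasFDerivAt_normalSq a x).differentiableAt hf
      (∑ i, b i * c i / a i) v
    rw [fderiv_normalSq_apply, smul_eq_mul] at h2
    rw [← h2, show (fun y => (normalSq a y)⁻¹ • ∑ i, b i * c i / a i) =
      fun y => (ellipsoidMetric a ha).form y b c from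
        funext fun y => (ellipsoidMetric_form_apply ha y b c).symm, h1.fderiv]
    simp
  have h0 : (ellipsoidMetric a ha).form x q w = (normalSq a x)⁻¹ * ∑ i, q i * w i / a i :=
    ellipsoidMetric_form_apply ha x q w
  have h1 : ∑ i, (q i / a i - normalSqDeriv a x p / normalSq a x * (p i / a i) +
        (∑ j, p j ^ 2 / a j) / normalSq a x * (x i / a i ^ 2)) * w i =
      ∑ i, q i * w i / a i - normalSqDeriv a x p / normalSq a x * ∑ i, p i * w i / a i +
        (∑ j, p j ^ 2 / a j) / normalSq a x * (normalSqDeriv a x w / 2) := by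
    simp only [normalSqDeriv, mul_div_cancel_left₀ _ (two_ne_zero' ℝ)]
    generalize (∑ j, p j ^ 2 / a j) / normalSq a x = e
    generalize 2 * (∑ i, x i / a i * (p i / a i)) / normalSq a x = d
    rw [Finset.mul_sum, Finset.mul_sum, ← Finset.sum_sub_distrib, ← Finset.sum_add_distrib]
    exact Finset.sum_congr rfl fun i _ => by ring
  have h2 : ∑ i, p i * p i / a i = ∑ i, p i ^ 2 / a i := by simp only [pow_two]
  rw [MetricNear.eulerLagrange, h0, hd, hd, h1, h2]
  field_simp
  ring

theorem eulerLagrange_ellipsoidMetric_iff {n : ℕ} {a : Fin n → ℝ} (ha : ∀ i, 0 < a i)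
    {x p q : EuclideanSpace ℝ (Fin n)} (hx : x ∈ ellipsoid a) (hp : conormal a x p = 0)
    (hq : conormal a x q = - ∑ i, p i ^ 2 / a i) :
    (∀ w, conormal a x w = 0 → (ellipsoidMetric a ha).eulerLagrange x p q w = 0) ↔
      EllipsoidEq a 1 x p q := by
  have hf := (normalSq_pos ha hx).ne'
  simp only [eulerLagrange_ellipsoidMetric ha hx, mul_eq_zero, inv_eq_zero, hf, false_or]
  rw [forall_sum_mul_eq_zero_iff ha hx, EllipsoidEq]
  simp only [one_mul]
  set d := normalSqDeriv a x p / normalSq a x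
  set e := (∑ j, p j ^ 2 / a j) / normalSq a x with he
  constructor
  · rintro ⟨r, hr⟩
    have hr' : ∀ i, q i = d * p i - e * (x i / a i) + r * x i := by
      intro i
      have hi := hr i
      have := (ha i).ne'
      field_simp at hi ⊢
      linarith
    -- The position vector pairs to 1 with the conormal on the ellipsoid, so this pairing isolates
    -- the multiplier `r`.
    have h1 : conormal a x q = d * conormal a x p - e * normalSq a x + r := by
      rw [← mul_one r, ← show ∑ i, x i ^ 2 / a i = 1 from hx]
      simp only [conormal_apply, normalSq, Finset.mul_sum]
      rw [← Finset.sum_sub_distrib, ← Finset.sum_add_distrib]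
      exact Finset.sum_congr rfl fun i _ => by rw [hr' i]; ring
    have h2 : r = 0 := by
      rw [hq, hp, he, div_mul_cancel₀ _ hf] at h1
      linarith
    intro i
    rw [hr', h2]
    ring
  · intro h
    refine ⟨0, fun i => ?_⟩
    have := (ha i).ne'
    rw [h i]
    field_simp
    ring

end

/-! ### Comparison of the unparametrized geodesics -/

/-- `EllipsoidEq` describes the geodesics of the restriction to the ellipsoid of the metric `g`. -/
def GeodesicsSatisfy {n : ℕ} {a : Fin n → ℝ} (g : MetricNear (ellipsoid a)) (δ : ℝ) : Prop :=
  ∀ x p q, x ∈ ellipsoid a → conormal a x p = 0 → conormal a x q = - ∑ i, p i ^ 2 / a i →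
    ((∀ w, conormal a x w = 0 → g.eulerLagrange x p q w = 0) ↔ EllipsoidEq a δ x p q)

theorem GeodesicsSatisfy.geodesicEq_iff {n : ℕ} {a : Fin n → ℝ}
    {g : MetricNear (ellipsoid a)} {δ : ℝ} (hg : GeodesicsSatisfy g δ)
    (P : LocalParametrization (ellipsoid a) (n - 1)) {u : ℝ → EuclideanSpace ℝ (Fin (n - 1))}
    {t : ℝ} (hu : u t ∈ P.source) (hut : ContDiffAt ℝ ∞ u t) :
    (∀ k, deriv (deriv u) t k +
      ∑ i, ∑ j, P.christoffel g (u t) k i j * deriv u t i * deriv u t j = 0) ↔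
    EllipsoidEq a δ (P.toFun (u t)) (deriv (P.toFun ∘ u) t) (deriv (deriv (P.toFun ∘ u)) t) := by
  obtain ⟨hp, hq⟩ := conormal_deriv_of_mem_ellipsoid ((P.contDiffAt hu).comp t hut)
    ((hut.continuousAt.eventually (P.open_source.mem_nhds hu)).mono fun s hs => P.mem hs)
  rw [← hg _ _ _ (P.mem hu) hp hq, P.geodesicEq_iff_eulerLagrange g hu, (P.deriv_comp hu hut).1,
    (P.deriv_comp hu hut).2]
  constructor
  · intro h w hw
    obtain ⟨z, rfl⟩ := (P.exists_fderiv_eq_iff hu w).2 hw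
    exact h z
  · exact fun h z => h _ ((P.exists_fderiv_eq_iff hu _).1 ⟨z, rfl⟩)

/-- The normal term is quadratic in the velocity, so it scales by r² like `q`; the added multiple of
`p` turns the coefficient δ into δ'. -/
theorem EllipsoidEq.reparametrize {n : ℕ} {a : Fin n → ℝ} {δ δ' r : ℝ}
    {x p q : EuclideanSpace ℝ (Fin n)} (h : EllipsoidEq a δ x p q) :
    EllipsoidEq a δ' x (r • p)
      (r ^ 2 • q + ((δ' - δ) * (normalSqDeriv a x p / normalSq a x) * r * r) • p) := by
  intro i
  have h1 : normalSqDeriv a x (r • p) = r * normalSqDeriv a x p := by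
    simp only [normalSqDeriv, PiLp.smul_apply, smul_eq_mul, Finset.mul_sum]
    exact Finset.sum_congr rfl fun i _ => by ring
  have h2 : ∑ j, (r • p) j ^ 2 / a j = r ^ 2 * ∑ j, p j ^ 2 / a j := by
    simp only [PiLp.smul_apply, smul_eq_mul, Finset.mul_sum]
    exact Finset.sum_congr rfl fun i _ => by ring
  rw [h1, h2]
  simp only [PiLp.add_apply, PiLp.smul_apply, smul_eq_mul, h i]
  ring

/-- If the equations of the geodesics of `g` and `g'` differ by `(δ' - δ) (log f)'` times the
velocity, and `R` is `f` to the power `δ' - δ`, then the change of parameter with speed `R` turns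
geodesics of `g` into geodesics of `g'`. -/
theorem IsUnparametrizedGeodesicOn.of_geodesicsSatisfy {n : ℕ} {a : Fin n → ℝ}
    {g g' : MetricNear (ellipsoid a)} {δ δ' : ℝ} (hg : GeodesicsSatisfy g δ)
    (hg' : GeodesicsSatisfy g' δ') {R : EuclideanSpace ℝ (Fin n) → ℝ}
    (hRpos : ∀ x ∈ ellipsoid a, 0 < R x) (hR : ∀ x ∈ ellipsoid a, ContDiffAt ℝ ∞ R x)
    (hRd : ∀ x ∈ ellipsoid a, ∀ p,
      fderiv ℝ R x p = (δ' - δ) * (normalSqDeriv a x p / normalSq a x) * R x)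
    {I : Set ℝ} {γ : ℝ → EuclideanSpace ℝ (Fin n)}
    (h : IsUnparametrizedGeodesicOn (n - 1) g γ I) :
    IsUnparametrizedGeodesicOn (n - 1) g' γ I := by
  obtain ⟨J, τ, hJ, hJc, hτ, hτpos, rfl, hgeo⟩ := h
  have hcs : ∀ t ∈ J, ContDiffAt ℝ ∞ (γ ∘ τ) t ∧ (γ ∘ τ) t ∈ ellipsoid a := by
    intro t ht
    obtain ⟨P, u, hu, hut, hev, -⟩ := hgeo t ht
    refine ⟨((P.contDiffAt hu).comp t hut).congr_of_eventuallyEq hev, ?_⟩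
    rw [hev.self_of_nhds]
    exact P.mem hu
  obtain ⟨K, σ, hK, hKc, hσ, hσK, hσd⟩ := exists_reparametrization (ρ := R ∘ γ ∘ τ) hJ hJc
    (fun t ht => ((hR _ (hcs t ht).2).comp t (hcs t ht).1).contDiffWithinAt)
    (fun t ht => hRpos _ (hcs t ht).2)
  have hmaps : Set.MapsTo σ K J := fun s hs => hσK ▸ Set.mem_image_of_mem σ hs
  refine ⟨K, τ ∘ σ, hK, hKc, hτ.comp hσ hmaps, ?_, by rw [Set.image_comp, hσK], ?_⟩
  · intro s hs
    have hd := ((hτ.contDiffAt (hJ.mem_nhds (hmaps hs))).differentiableAt (by simp)).hasDerivAt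
    rw [(hd.comp s (hσd s hs)).deriv]
    exact mul_pos (hτpos _ (hmaps hs)) (hRpos _ (hcs _ (hmaps hs)).2)
  · intro s hs
    obtain ⟨P, u, hu, hut, hev, heq⟩ := hgeo (σ s) (hmaps hs)
    have hσs := hσ.contDiffAt (hK.mem_nhds hs)
    have hus : ContDiffAt ℝ ∞ (u ∘ σ) s := hut.comp s hσs
    refine ⟨P, u ∘ σ, hu, hus, hσs.continuousAt.eventually hev, ?_⟩
    rw [hg.geodesicEq_iff P hu hut] at heq
    have hus' : (u ∘ σ) s ∈ P.source := hu
    rw [hg'.geodesicEq_iff P hus' hus]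
    have hc : ContDiffAt ℝ ∞ (P.toFun ∘ u) (σ s) := (P.contDiffAt hu).comp (σ s) hut
    have hRc := ((hR _ (P.mem hu)).differentiableAt (by simp)).hasFDerivAt.comp_hasDerivAt (σ s)
      (hc.differentiableAt (by simp)).hasDerivAt
    rw [hRd _ (P.mem hu)] at hRc
    -- The differential equation for σ is transferred to the coordinate expression, which agrees
    -- with `γ ∘ τ` only locally.
    have hσev : ∀ᶠ r in nhds s, HasDerivAt σ ((R ∘ P.toFun ∘ u) (σ r)) r := by
      filter_upwards [hK.mem_nhds hs, hσs.continuousAt.eventually hev] with r hr hre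
      have := hσd r hr
      rwa [Function.comp_apply, hre] at this
    obtain ⟨h1, h2⟩ := deriv_deriv_comp hc hσev hRc
    rw [← Function.comp_assoc, h1, h2]
    exact heq.reparametrize

theorem geodesicsSatisfy_euclideanMetric {n : ℕ} {a : Fin n → ℝ} (ha : ∀ i, 0 < a i) :
    GeodesicsSatisfy (euclideanMetric (ellipsoid a)) 0 :=
  fun _ _ _ hx _ hq => eulerLagrange_euclideanMetric_iff ha hx hq

theorem geodesicsSatisfy_ellipsoidMetric {n : ℕ} {a : Fin n → ℝ} (ha : ∀ i, 0 < a i) :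
    GeodesicsSatisfy (ellipsoidMetric a ha) 1 :=
  fun _ _ _ hx hp hq => eulerLagrange_ellipsoidMetric_iff ha hx hp hq

theorem theorem3 {n : ℕ} (a : Fin n → ℝ) (ha : ∀ i, 0 < a i) :
    GeodesicallyEquivalent (n - 1) (euclideanMetric (ellipsoid a)) (ellipsoidMetric a ha) := by
  intro I γ _ _
  constructor
  -- Here δ' - δ = 1, so the speed is f itself; in the converse direction the exponent is -1.
  · refine IsUnparametrizedGeodesicOn.of_geodesicsSatisfy (geodesicsSatisfy_euclideanMetric ha)
      (geodesicsSatisfy_ellipsoidMetric ha) (R := normalSq a) (fun x hx => normalSq_pos ha hx)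
      (fun x _ => (contDiff_normalSq a).contDiffAt) fun x hx p => ?_
    have hf := (normalSq_pos ha hx).ne'
    rw [fderiv_normalSq_apply]
    field_simp
    ring
  · refine IsUnparametrizedGeodesicOn.of_geodesicsSatisfy (geodesicsSatisfy_ellipsoidMetric ha)
      (geodesicsSatisfy_euclideanMetric ha) (R := fun y => (normalSq a y)⁻¹)
      (fun x hx => inv_pos.2 (normalSq_pos ha hx))
      (fun x hx => (contDiff_normalSq a).contDiffAt.inv (normalSq_pos ha hx).ne')
      fun x hx p => ?_
    have hf := (normalSq_pos ha hx).ne'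
    have h := (hasDerivAt_inv hf).comp_hasFDerivAt x
      (hasFDerivAt_normalSq a x).differentiableAt.hasFDerivAt
    have h' : fderiv ℝ (fun y => (normalSq a y)⁻¹) x = _ := h.fderiv
    rw [h', smul_apply, fderiv_normalSq_apply, smul_eq_mul]
    field_simp
    ring
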